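/- Formulas are built from countably many propositional variables and $\bot$ by the Boolean connectives and the modalities $[n]$, $n\in\omega$; $\langle n\rangle\varphi$ abbreviates $\neg[n]\neg\varphi$. The logic $\mathbf{GLP}$ has as axioms all Boolean tautologies of this language and all formulas - $[n](\varphi\to\psi)\to([n]\varphi\to[n]\psi)$, - $[n]([n]\varphi\to\varphi)\to[n]\varphi$, - $[m]\varphi\to[n]\varphi$ for $m<n$, - $\langle m\rangle\varphi\to[n]\langle m\rangle\varphi$ for $m<n$, and as rules modus ponens and necessitation ($\varphi\,/\,[n]\varphi$ for each $n\in\omega$). For a topology $\tau$ on a set $X$ and $A\subseteq X$, let $d_\tau(A)$ be the set of limit points of $A$, i.e. of all $x$ such that every open neighborhood of $x$ contains a point $y\ne x$ of $A$. A topology is scattered if every nonempty subspace has an isolated point. A GLP-space is a nonempty set $X$ with topologies $\tau_0,\tau_1,\dots$ such that, for every $n\in\omega$: $\tau_n$ is scattered; $\tau_n\subseteq\tau_{n+1}$; and $d_{\tau_n}(A)$ is $\tau_{n+1}$-open for every $A\subseteq X$. A valuation $v$ assigns a subset of $X$ to each variable and extends to all formulas by interpreting the Boolean connectives as the set operations and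 putting $v([n]\varphi)=X\setminus d_{\tau_n}(X\setminus v(\varphi))$, so that $v(\langle n\rangle\varphi)=d_{\tau_n}(v(\varphi))$. A formula $\varphi$ is valid in the GLP-space if $v(\varphi)=X$ for every valuation $v$; otherwise it is refuted on it. Theorem (topological completeness of $\mathbf{GLP}$). Every formula that is not provable in $\mathbf{GLP}$ is refuted on some GLP-space. Moreover, $\mathbf{GLP}$ is the logic of the class of all GLP-spaces: a formula is provable in $\mathbf{GLP}$ if and only if it is valid in every GLP-space. -/

import Mathlib

universe u

namespace GLP

/-- Formulas of the modal language with modalities `[0], [1], [2], …` over countably many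
propositional variables. -/
inductive Formula : Type where
  | var : ℕ → Formula
  | bot : Formula
  | imp : Formula → Formula → Formula
  | box : ℕ → Formula → Formula

namespace Formula

def neg (φ : Formula) : Formula := imp φ bot

def or (φ ψ : Formula) : Formula := imp (neg φ) ψ

def and (φ ψ : Formula) : Formula := neg (imp φ (neg ψ))

/-- `⟨n⟩φ` is `¬[n]¬φ`. -/
def dia (n : ℕ) (φ : Formula) : Formula := neg (box n (neg φ))

/-- Propositional truth under an assignment `e` of truth values to the variables and to the
formulas `[n]φ`, which count as atoms here. -/
def propTruth (e : Formula → Prop) : Formula → Prop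
  | var p => e (var p)
  | bot => False
  | imp φ ψ => propTruth e φ → propTruth e ψ
  | box n φ => e (box n φ)

/-- Boolean tautologies of the modal language. -/
def IsTautology (φ : Formula) : Prop := ∀ e : Formula → Prop, propTruth e φ

end Formula

open Formula
open scoped Topology

/-- `Provable φ` is `GLP ⊢ φ`. -/
inductive Provable : Formula → Prop where
  | taut (φ : Formula) : IsTautology φ → Provable φ
  | distrib (n : ℕ) (φ ψ : Formula) :
      Provable (imp (box n (imp φ ψ)) (imp (box n φ) (box n ψ)))
  | loeb (n : ℕ) (φ : Formula) : Provable (imp (box n (imp (box n φ) φ)) (box n φ))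
  | mono (m n : ℕ) (φ : Formula) : m < n → Provable (imp (box m φ) (box n φ))
  | negIntro (m n : ℕ) (φ : Formula) : m < n → Provable (imp (dia m φ) (box n (dia m φ)))
  | mp (φ ψ : Formula) : Provable φ → Provable (imp φ ψ) → Provable ψ
  | nec (n : ℕ) (φ : Formula) : Provable φ → Provable (box n φ)

/-- The extension of a valuation `v` to all formulas in the neighborhood frame
`(X, δ 0, δ 1, …)`; `δ n` interprets `⟨n⟩`, and its dual interprets `[n]`. -/
def value {X : Type*} (δ : ℕ → Set X → Set X) (v : ℕ → Set X) : Formula → Set X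
  | var p => v p
  | bot => ∅
  | imp φ ψ => (value δ v φ)ᶜ ∪ value δ v ψ
  | box n φ => (δ n (value δ v φ)ᶜ)ᶜ

theorem value_neg {X : Type*} (δ : ℕ → Set X → Set X) (v : ℕ → Set X) (φ : Formula) :
    value δ v (neg φ) = (value δ v φ)ᶜ := by
  simp [neg, value]

theorem value_or {X : Type*} (δ : ℕ → Set X → Set X) (v : ℕ → Set X) (φ ψ : Formula) :
    value δ v (Formula.or φ ψ) = value δ v φ ∪ value δ v ψ := by
  simp [Formula.or, neg, value]

theorem value_dia {X : Type*} (δ : ℕ → Set X → Set X) (v : ℕ → Set X) (n : ℕ) (φ : Formula) :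
    value δ v (dia n φ) = δ n (value δ v φ) := by
  simp [dia, neg, value]

/-- `φ` is valid in the neighborhood frame `(X, δ 0, δ 1, …)`. -/
def Valid {X : Type*} (δ : ℕ → Set X → Set X) (φ : Formula) : Prop :=
  ∀ v : ℕ → Set X, value δ v φ = Set.univ

/-- Every nonempty subspace has an isolated point. -/
def IsScattered {X : Type*} (τ : TopologicalSpace X) : Prop :=
  ∀ A : Set X, A.Nonempty → ∃ x ∈ A, ∃ U : Set X, IsOpen[τ] U ∧ U ∩ A = {x}

/-- The derived set operators of a sequence of topologies. -/
def derivedOps {X : Type*} (τ : ℕ → TopologicalSpace X) (n : ℕ) (A : Set X) : Set X :=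
  @derivedSet X (τ n) A

/-- `(X, τ 0, τ 1, …)` is a GLP-space. -/
structure IsGLPSpace {X : Type*} (τ : ℕ → TopologicalSpace X) : Prop where
  nonempty : Nonempty X
  scattered : ∀ n, IsScattered (τ n)
  increasing : ∀ n (U : Set X), IsOpen[τ n] U → IsOpen[τ (n + 1)] U
  derived_open : ∀ n (A : Set X), IsOpen[τ (n + 1)] (derivedOps τ n A)

/-- The logic of the class of all GLP-spaces (with carriers in the universe `u`). -/
def logicOfGLPSpaces : Set Formula :=
  {φ | ∀ (X : Type u) (τ : ℕ → TopologicalSpace X), IsGLPSpace τ → Valid (derivedOps τ) φ}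

end GLP

/-!
Completeness is proved by a canonical model whose points are maximal consistent sets, made into a
GLP-space topologically.

The canonical relations are not converse well-founded, so only the points of their well-founded part
are used. This part still refutes every unprovable formula: for a finite set `Δ` of formulas closed
under subformulas and a maximal consistent set `w`, a new point whose `[j]`-successors are exactly
the founded theories compatible with `Δ ∩ w` has a founded theory that agrees with `w` on `Δ`. The
agreement is proved by induction along `[j]`-successors at which a failing `[j]ψ` becomes true,
which is well-founded because `Δ` is finite.

On the founded points, start from the topology of the sets closed under points of smaller rank, and
for `n = 0, 1, …` refine it so that a point satisfying `[n]χ` has `χ` true at all nearby points, and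
then to a finest topology in which the converse still holds: `[n]ψ` is true wherever `ψ` is true at
all nearby points. By maximality, if `O` is open and `O ∪ {b}` is not, then some `[n]ψ` fails at `b`
although `ψ` is true at all points of `O` near `b`. Applied to the complement of the closure of `Y`
and a limit point `b` of `Y`, this shows that all points near `b` at which `[n]ψ` fails are limit
points of `Y`. Since `¬[n]ψ` implies `[n+1]¬[n]ψ`, derived sets become open at the next stage.
-/

namespace GLP

open Filter Formula
open scoped Function
open scoped Topology

/-! ### Maximal consistent sets -/

/-- Derivability in `GLP` from a set of hypotheses. Necessitation applies to theorems of `GLP` only,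
so that the deduction theorem holds. -/
inductive DerivableFrom (Γ : Set Formula) : Formula → Prop where
  | hyp {φ : Formula} : φ ∈ Γ → DerivableFrom Γ φ
  | thm {φ : Formula} : Provable φ → DerivableFrom Γ φ
  | mp {φ ψ : Formula} : DerivableFrom Γ φ → DerivableFrom Γ (imp φ ψ) → DerivableFrom Γ ψ

namespace DerivableFrom

variable {Γ Γ' : Set Formula} {φ ψ : Formula}

theorem mono (h : Γ ⊆ Γ') (d : DerivableFrom Γ φ) : DerivableFrom Γ' φ := by
  induction d with
  | hyp hφ => exact .hyp (h hφ)
  | thm hφ => exact .thm hφ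
  | mp _ _ ihφ ihimp => exact .mp ihφ ihimp

theorem of_isTautology (h : IsTautology φ) : DerivableFrom Γ φ :=
  .thm (.taut _ h)

theorem imp_of_right (d : DerivableFrom Γ ψ) : DerivableFrom Γ (imp φ ψ) :=
  d.mp (of_isTautology fun _ hψ _ => hψ)

theorem deduction (d : DerivableFrom (insert φ Γ) ψ) : DerivableFrom Γ (imp φ ψ) := by
  induction d with
  | hyp hχ =>
    rcases hχ with rfl | hχ
    · exact of_isTautology fun _ => id
    · exact (hyp hχ).imp_of_right
  | thm hχ => exact (thm hχ).imp_of_right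
  | mp _ _ ihχ ihimp => exact ihχ.mp (ihimp.mp (of_isTautology fun _ hφχθ hφχ hφ =>
      hφχθ hφ (hφχ hφ)))

theorem exists_mem_of_sUnion {c : Set (Set Formula)} (hc : IsChain (· ⊆ ·) c) (hne : c.Nonempty)
    (d : DerivableFrom (⋃₀ c) φ) : ∃ Γ ∈ c, DerivableFrom Γ φ := by
  induction d with
  | hyp hφ =>
    obtain ⟨Γ, hΓ, hφ⟩ := hφ
    exact ⟨Γ, hΓ, .hyp hφ⟩
  | thm hφ =>
    obtain ⟨Γ, hΓ⟩ := hne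
    exact ⟨Γ, hΓ, .thm hφ⟩
  | mp _ _ ihφ ihimp =>
    obtain ⟨Γ₁, h₁, dφ⟩ := ihφ
    obtain ⟨Γ₂, h₂, dimp⟩ := ihimp
    rcases hc.total h₁ h₂ with h | h
    · exact ⟨Γ₂, h₂, (dφ.mono h).mp dimp⟩
    · exact ⟨Γ₁, h₁, dφ.mp (dimp.mono h)⟩

theorem provable (d : DerivableFrom ∅ φ) : Provable φ := by
  induction d with
  | hyp hφ => exact hφ.elim
  | thm hφ => exact hφ
  | mp _ _ ihφ ihimp => exact .mp _ _ ihφ ihimp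

end DerivableFrom

/-- Maximal `GLP`-consistent sets of formulas, described as the sets that contain all theorems and
commute with the propositional connectives. -/
structure IsMaxConsistent (t : Set Formula) : Prop where
  bot_notMem : bot ∉ t
  imp_mem_iff : ∀ φ ψ, imp φ ψ ∈ t ↔ (φ ∈ t → ψ ∈ t)
  mem_of_provable : ∀ φ, Provable φ → φ ∈ t

theorem isMaxConsistent_of_maximal {t : Set Formula} {φ : Formula}
    (ht : Maximal (fun Γ => ¬ DerivableFrom Γ φ) t) : IsMaxConsistent t := by
  have imp_of_notMem : ∀ ψ, ψ ∉ t → DerivableFrom t (imp ψ φ) := fun ψ hψ => by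
    by_contra hd
    exact hψ (ht.le_of_ge (fun d => hd d.deduction) (Set.subset_insert ψ t) (Set.mem_insert ψ t))
  have mem_of_derivable : ∀ ψ, DerivableFrom t ψ → ψ ∈ t := fun ψ d => by
    by_contra hψ
    exact ht.prop (d.mp (imp_of_notMem ψ hψ))
  refine ⟨fun hbot => ?_, fun ψ χ => ⟨fun himp hψ => ?_, fun h => ?_⟩,
    fun ψ hψ => mem_of_derivable ψ (.thm hψ)⟩
  · exact ht.prop (.mp (.hyp hbot) (.of_isTautology fun _ => False.elim))
  · exact mem_of_derivable χ (.mp (.hyp hψ) (.hyp himp))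
  · by_cases hψ : ψ ∈ t
    · exact mem_of_derivable _ (DerivableFrom.hyp (h hψ)).imp_of_right
    · by_contra himp
      refine ht.prop (.mp (imp_of_notMem _ himp) (.mp (imp_of_notMem _ hψ) (.of_isTautology ?_)))
      intro e
      simp only [propTruth]
      tauto

theorem exists_isMaxConsistent_of_not_derivableFrom {Γ : Set Formula} {φ : Formula}
    (h : ¬ DerivableFrom Γ φ) : ∃ t, IsMaxConsistent t ∧ Γ ⊆ t ∧ φ ∉ t := by
  obtain ⟨t, hΓt, ht⟩ := zorn_subset_nonempty {Δ | ¬ DerivableFrom Δ φ} (fun c hcφ hc hne =>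
    ⟨⋃₀ c, fun d => by
      obtain ⟨Δ, hΔ, d⟩ := d.exists_mem_of_sUnion hc hne
      exact hcφ hΔ d, fun _ => Set.subset_sUnion_of_mem⟩) Γ h
  exact ⟨t, isMaxConsistent_of_maximal ht, hΓt, fun hφ => ht.prop (.hyp hφ)⟩

theorem provable_of_forall_isMaxConsistent {φ : Formula}
    (h : ∀ t, IsMaxConsistent t → φ ∈ t) : Provable φ := by
  by_contra hφ
  obtain ⟨t, ht, -, hφt⟩ :=
    exists_isMaxConsistent_of_not_derivableFrom (mt DerivableFrom.provable hφ)
  exact hφt (h t ht)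

namespace IsMaxConsistent

variable {t : Set Formula} {m n : ℕ} {φ ψ : Formula}

theorem neg_mem_iff (ht : IsMaxConsistent t) (φ : Formula) : neg φ ∈ t ↔ φ ∉ t := by
  simp only [neg, ht.imp_mem_iff, ht.bot_notMem, imp_false]

theorem and_mem_iff (ht : IsMaxConsistent t) (φ ψ : Formula) :
    Formula.and φ ψ ∈ t ↔ φ ∈ t ∧ ψ ∈ t := by
  simp only [Formula.and, ht.neg_mem_iff, ht.imp_mem_iff, Classical.not_imp, not_not]

theorem mem_of_provable_imp (ht : IsMaxConsistent t) (h : Provable (imp φ ψ)) (hφ : φ ∈ t) :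
    ψ ∈ t :=
  (ht.imp_mem_iff _ _).1 (ht.mem_of_provable _ h) hφ

theorem box_mp (ht : IsMaxConsistent t) (himp : box n (imp φ ψ) ∈ t) (hφ : box n φ ∈ t) :
    box n ψ ∈ t :=
  (ht.imp_mem_iff _ _).1 (ht.mem_of_provable_imp (.distrib n φ ψ) himp) hφ

theorem box_mem_of_entails (ht : IsMaxConsistent t)
    (h : ∀ s, IsMaxConsistent s → φ ∈ s → ψ ∈ s) (hφ : box n φ ∈ t) : box n ψ ∈ t := by
  have himp : Provable (imp φ ψ) :=
    provable_of_forall_isMaxConsistent fun s hs => (hs.imp_mem_iff _ _).2 (h s hs)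
  exact ht.box_mp (ht.mem_of_provable _ (.nec n _ himp)) hφ

theorem box_mem_of_derivableFrom (ht : IsMaxConsistent t)
    (d : DerivableFrom {χ | box n χ ∈ t} φ) : box n φ ∈ t := by
  induction d with
  | hyp hφ => exact hφ
  | thm hφ => exact ht.mem_of_provable _ (.nec n _ hφ)
  | mp _ _ ihφ ihimp => exact ht.box_mp ihimp ihφ

theorem box_and_mem_iff (ht : IsMaxConsistent t) :
    box n (Formula.and φ ψ) ∈ t ↔ box n φ ∈ t ∧ box n ψ ∈ t := by
  refine ⟨fun h => ⟨?_, ?_⟩, fun ⟨hφ, hψ⟩ => ?_⟩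
  · exact ht.box_mem_of_entails (fun s hs h => ((hs.and_mem_iff _ _).1 h).1) h
  · exact ht.box_mem_of_entails (fun s hs h => ((hs.and_mem_iff _ _).1 h).2) h
  · refine ht.box_mp (ht.box_mem_of_entails (fun s hs h => ?_) hφ) hψ
    exact (hs.imp_mem_iff _ _).2 fun h' => (hs.and_mem_iff _ _).2 ⟨h, h'⟩

theorem box_mem_of_le (ht : IsMaxConsistent t) (hmn : m ≤ n) (hφ : box m φ ∈ t) :
    box n φ ∈ t := by
  rcases hmn.eq_or_lt with rfl | hmn
  · exact hφ
  · exact ht.mem_of_provable_imp (.mono m n φ hmn) hφ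

theorem box_mem_of_box_imp (ht : IsMaxConsistent t) (h : box n (imp (box n φ) φ) ∈ t) :
    box n φ ∈ t :=
  ht.mem_of_provable_imp (.loeb n φ) h

-- Löb's axiom is applied to `φ ∧ [n]φ`.
theorem box_box_mem (ht : IsMaxConsistent t) (h : box n φ ∈ t) : box n (box n φ) ∈ t := by
  have hand : box n (Formula.and φ (box n φ)) ∈ t := by
    refine ht.box_mem_of_box_imp (ht.box_mem_of_entails (fun s hs hφ => ?_) h)
    exact (hs.imp_mem_iff _ _).2 fun hbox =>
      (hs.and_mem_iff _ _).2 ⟨hφ, (hs.box_and_mem_iff.1 hbox).1⟩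
  exact (ht.box_and_mem_iff.1 hand).2

theorem box_neg_box_mem (ht : IsMaxConsistent t) (hmn : m < n) (h : box m φ ∉ t) :
    box n (neg (box m φ)) ∈ t := by
  have not_not_iff : ∀ s, IsMaxConsistent s → (box m (neg (neg φ)) ∈ s ↔ box m φ ∈ s) :=
    fun s hs =>
      ⟨hs.box_mem_of_entails fun r hr => by simp only [hr.neg_mem_iff, not_not, imp_self],
        hs.box_mem_of_entails fun r hr => by simp only [hr.neg_mem_iff, not_not, imp_self]⟩
  have hdia : dia m (neg φ) ∈ t := by rwa [dia, ht.neg_mem_iff, not_not_iff t ht]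
  refine ht.box_mem_of_entails (fun s hs hs' => ?_)
    (ht.mem_of_provable_imp (.negIntro m n (neg φ) hmn) hdia)
  rwa [dia, hs.neg_mem_iff, not_not_iff s hs, ← hs.neg_mem_iff] at hs'

end IsMaxConsistent

/-- The accessibility relation of the canonical model for the modality `[j]`. -/
structure CanonicalRel (j : ℕ) (t s : Set Formula) : Prop where
  mem_and_box_mem : ∀ ψ, box j ψ ∈ t → ψ ∈ s ∧ box j ψ ∈ s
  box_mem_iff : ∀ i < j, ∀ ψ, box i ψ ∈ t ↔ box i ψ ∈ s

theorem CanonicalRel.mem_and_box_mem_of_le {i j : ℕ} {t s : Set Formula} {ψ : Formula}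
    (h : CanonicalRel j t s) (ht : IsMaxConsistent t) (hij : i ≤ j) (hψ : box i ψ ∈ t) :
    ψ ∈ s ∧ box i ψ ∈ s := by
  refine ⟨(h.mem_and_box_mem ψ (ht.box_mem_of_le hij hψ)).1, ?_⟩
  rcases hij.eq_or_lt with rfl | hij
  · exact (h.mem_and_box_mem ψ hψ).2
  · exact (h.box_mem_iff i hij ψ).1 hψ

theorem IsMaxConsistent.exists_canonicalRel {t : Set Formula} (ht : IsMaxConsistent t) {j : ℕ}
    {ψ : Formula} (h : box j ψ ∉ t) :
    ∃ s, IsMaxConsistent s ∧ CanonicalRel j t s ∧ ψ ∉ s ∧ box j ψ ∈ s := by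
  have hd : ¬ DerivableFrom (insert (box j ψ) {χ | box j χ ∈ t}) ψ := fun d =>
    h (ht.box_mem_of_box_imp (ht.box_mem_of_derivableFrom d.deduction))
  obtain ⟨s, hs, hsub, hψ⟩ := exists_isMaxConsistent_of_not_derivableFrom hd
  have mem_of_box_mem : ∀ χ, box j χ ∈ t → χ ∈ s := fun χ hχ => hsub (Set.mem_insert_of_mem _ hχ)
  refine ⟨s, hs, ⟨fun χ hχ => ⟨mem_of_box_mem _ hχ, mem_of_box_mem _ (ht.box_box_mem hχ)⟩,
    fun i hi χ => ⟨fun hχ => ?_, fun hχ => ?_⟩⟩, hψ, hsub (Set.mem_insert _ _)⟩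
  · exact mem_of_box_mem _ (ht.box_mem_of_le hi.le (ht.box_box_mem hχ))
  · by_contra hn
    exact (hs.neg_mem_iff _).1 (mem_of_box_mem _ (ht.box_neg_box_mem hi hn)) hχ

/-! ### Realizing finite types in the well-founded part of the canonical model -/

/-- The `α`-th stage of the well-founded part of the canonical model: the maximal consistent sets
every failure `[j]ψ ∉ t` of which is witnessed by a `[j]`-successor of an earlier stage. -/
def FoundedAt (α : Ordinal.{0}) (t : Set Formula) : Prop :=
  IsMaxConsistent t ∧ ∀ j ψ, box j ψ ∉ t →
    ∃ β, ∃ _ : β < α, ∃ s, FoundedAt β s ∧ CanonicalRel j t s ∧ ψ ∉ s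
termination_by α

theorem foundedAt_iff {α : Ordinal.{0}} {t : Set Formula} : FoundedAt α t ↔
    IsMaxConsistent t ∧ ∀ j ψ, box j ψ ∉ t →
      ∃ β < α, ∃ s, FoundedAt β s ∧ CanonicalRel j t s ∧ ψ ∉ s := by
  rw [FoundedAt]
  simp only [exists_prop]

/-- Membership in the well-founded part of the canonical model. -/
def IsFounded (t : Set Formula) : Prop := ∃ α, FoundedAt α t

theorem IsFounded.isMaxConsistent {t : Set Formula} (h : IsFounded t) : IsMaxConsistent t :=
  h.elim fun _ h => (foundedAt_iff.1 h).1

theorem IsFounded.exists_canonicalRel {t : Set Formula} (h : IsFounded t) {j : ℕ} {ψ : Formula}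
    (hψ : box j ψ ∉ t) : ∃ s, IsFounded s ∧ CanonicalRel j t s ∧ ψ ∉ s := by
  obtain ⟨α, h⟩ := h
  obtain ⟨β, -, s, hs, hts⟩ := (foundedAt_iff.1 h).2 j ψ hψ
  exact ⟨s, ⟨β, hs⟩, hts⟩

theorem IsMaxConsistent.isFounded {t : Set Formula} (ht : IsMaxConsistent t)
    (h : ∀ j ψ, box j ψ ∉ t → ∃ s, IsFounded s ∧ CanonicalRel j t s ∧ ψ ∉ s) : IsFounded t := by
  choose s hs hts using h
  choose β hβ using hs
  let rank : {p : ℕ × Formula // box p.1 p.2 ∉ t} → Ordinal.{0} := fun p => β p.1.1 p.1.2 p.2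
  refine ⟨Order.succ (iSup rank), foundedAt_iff.2 ⟨ht, fun j ψ hψ =>
    ⟨β j ψ hψ, ?_, s j ψ hψ, hβ j ψ hψ, hts j ψ hψ⟩⟩⟩
  exact Order.lt_succ_iff.2 (Ordinal.le_iSup rank ⟨(j, ψ), hψ⟩)

section PointTheory

variable {V : Set ℕ} {S : ℕ → Set (Set Formula)}

/-- The formulas true at a new point that satisfies the variables in `V` and sees the theories in
`S j` along `[j]`. -/
def pointTheory (V : Set ℕ) (S : ℕ → Set (Set Formula)) : Set Formula :=
  {φ | propTruth (fun
    | var p => p ∈ V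
    | box j ψ => ∀ s ∈ S j, ψ ∈ s
    | _ => False) φ}

theorem imp_mem_pointTheory {φ ψ : Formula} :
    imp φ ψ ∈ pointTheory V S ↔ (φ ∈ pointTheory V S → ψ ∈ pointTheory V S) := Iff.rfl

theorem box_mem_pointTheory {j : ℕ} {ψ : Formula} :
    box j ψ ∈ pointTheory V S ↔ ∀ s ∈ S j, ψ ∈ s := Iff.rfl

theorem isMaxConsistent_pointTheory (hmax : ∀ j, ∀ s ∈ S j, IsMaxConsistent s)
    (hrel : ∀ j, ∀ s ∈ S j, CanonicalRel j (pointTheory V S) s) (hanti : Antitone S) :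
    IsMaxConsistent (pointTheory V S) := by
  refine ⟨id, fun _ _ => imp_mem_pointTheory, fun φ hφ => ?_⟩
  induction hφ with
  | taut _ h => exact h _
  | distrib n φ ψ =>
    intro himp hφ s hs
    exact ((hmax n s hs).imp_mem_iff _ _).1 (himp s hs) (hφ s hs)
  | loeb n φ =>
    intro h s hs
    obtain ⟨himp, hbox⟩ := (hrel n s hs).mem_and_box_mem _ h
    exact ((hmax n s hs).imp_mem_iff _ _).1 himp ((hmax n s hs).box_mem_of_box_imp hbox)
  | mono m n φ hmn => exact fun h s hs => h s (hanti hmn.le hs)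
  | negIntro m n φ hmn =>
    intro h s hs
    rw [dia, (hmax n s hs).neg_mem_iff, ← (hrel n s hs).box_mem_iff m hmn]
    exact h
  | mp _ _ _ _ ihφ ihimp => exact ihimp ihφ
  | nec n φ h _ => exact fun s hs => (hmax n s hs).mem_of_provable φ h

theorem isFounded_pointTheory (hS : ∀ j, ∀ s ∈ S j, IsFounded s)
    (hrel : ∀ j, ∀ s ∈ S j, CanonicalRel j (pointTheory V S) s) (hanti : Antitone S) :
    IsFounded (pointTheory V S) := by
  have hmax := isMaxConsistent_pointTheory (fun j s hs => (hS j s hs).isMaxConsistent) hrel hanti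
  refine hmax.isFounded fun j ψ h => ?_
  rw [box_mem_pointTheory] at h
  push Not at h
  obtain ⟨s, hs, hψ⟩ := h
  exact ⟨s, hS j s hs, hrel j s hs, hψ⟩

end PointTheory

section Realization

/-- The founded theories that a point forcing the formulas `[i]ψ ∈ D` may see along `[j]`. The last
clause makes them agree with the point on all formulas `[i]ψ` with `i < j`. -/
def successors (D : Set Formula) (j : ℕ) : Set (Set Formula) :=
  {s | IsFounded s ∧ (∀ i ≤ j, ∀ ψ, box i ψ ∈ D → ψ ∈ s ∧ box i ψ ∈ s) ∧
    ∀ i, ∀ _ : i < j, ∀ ψ, box i ψ ∈ s ↔ ∀ r, r ∈ successors D i → ψ ∈ r}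
termination_by j

variable {D D' s r : Set Formula} {j : ℕ}

theorem mem_successors : s ∈ successors D j ↔
    IsFounded s ∧ (∀ i ≤ j, ∀ ψ, box i ψ ∈ D → ψ ∈ s ∧ box i ψ ∈ s) ∧
      ∀ i < j, ∀ ψ, box i ψ ∈ s ↔ ∀ r ∈ successors D i, ψ ∈ r := by
  rw [successors]
  exact Iff.rfl

theorem successors_congr (h : ∀ i ≤ j, ∀ ψ, box i ψ ∈ D ↔ box i ψ ∈ D') :
    successors D j = successors D' j := by
  induction j using Nat.strong_induction_on with
  | _ j ih =>
    ext s
    rw [mem_successors, mem_successors]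
    refine and_congr_right fun _ => and_congr
      (forall₂_congr fun i hi => forall_congr' fun ψ => by rw [h i hi ψ])
      (forall₂_congr fun i hi => forall_congr' fun ψ => ?_)
    rw [ih i hi fun k hk => h k (hk.trans hi.le)]

theorem antitone_successors (D : Set Formula) : Antitone (successors D) := fun i j hij s hs => by
  rw [mem_successors] at hs ⊢
  exact ⟨hs.1, fun k hk => hs.2.1 k (hk.trans hij), fun k hk => hs.2.2 k (hk.trans_le hij)⟩

theorem mem_successors_of_canonicalRel (hs : s ∈ successors D j) (hr : IsFounded r)
    (hsr : CanonicalRel j s r) : r ∈ successors D j := by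
  rw [mem_successors] at hs ⊢
  obtain ⟨hs, hD, hagree⟩ := hs
  refine ⟨hr, fun i hi ψ hψ => ?_, fun i hi ψ => ?_⟩
  · exact hsr.mem_and_box_mem_of_le hs.isMaxConsistent hi (hD i hi ψ hψ).2
  · rw [← hsr.box_mem_iff i hi, hagree i hi]

/-- The theory of the point that satisfies the variables in `D` and sees all of `successors D j`
along `[j]`. -/
def realization (D : Set Formula) : Set Formula := pointTheory {p | var p ∈ D} (successors D)

theorem canonicalRel_realization (hs : s ∈ successors D j) :
    CanonicalRel j (realization D) s := by
  obtain ⟨hfs, -, hagree⟩ := mem_successors.1 hs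
  refine ⟨fun ψ h => ⟨h s hs, ?_⟩, fun i hi ψ => (hagree i hi ψ).symm⟩
  by_contra hn
  obtain ⟨r, hr, hsr, hψ⟩ := hfs.exists_canonicalRel hn
  exact hψ (h r (mem_successors_of_canonicalRel hs hr hsr))

theorem isFounded_realization (D : Set Formula) : IsFounded (realization D) :=
  isFounded_pointTheory (fun _ _ hs => (mem_successors.1 hs).1)
    (fun _ _ => canonicalRel_realization) (antitone_successors D)

/-- Closure under subformulas. -/
structure IsSubformulaClosed (Δ : Set Formula) : Prop where
  left_mem : ∀ {φ ψ}, imp φ ψ ∈ Δ → φ ∈ Δ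
  right_mem : ∀ {φ ψ}, imp φ ψ ∈ Δ → ψ ∈ Δ
  body_mem : ∀ {i ψ}, box i ψ ∈ Δ → ψ ∈ Δ

theorem exists_finite_isSubformulaClosed (φ : Formula) :
    ∃ Δ : Set Formula, Δ.Finite ∧ IsSubformulaClosed Δ ∧ φ ∈ Δ := by
  induction φ with
  | var p => exact ⟨{var p}, Set.finite_singleton _, ⟨by simp, by simp, by simp⟩, rfl⟩
  | bot => exact ⟨{bot}, Set.finite_singleton _, ⟨by simp, by simp, by simp⟩, rfl⟩
  | imp φ ψ ihφ ihψ =>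
    obtain ⟨Δ₁, hfin₁, hΔ₁, hφ⟩ := ihφ
    obtain ⟨Δ₂, hfin₂, hΔ₂, hψ⟩ := ihψ
    refine ⟨insert (imp φ ψ) (Δ₁ ∪ Δ₂), (hfin₁.union hfin₂).insert _, ⟨?_, ?_, ?_⟩, .inl rfl⟩
    · grind [hΔ₁.left_mem, hΔ₂.left_mem]
    · grind [hΔ₁.right_mem, hΔ₂.right_mem]
    · grind [hΔ₁.body_mem, hΔ₂.body_mem]
  | box n φ ih =>
    obtain ⟨Δ, hfin, hΔ, hφ⟩ := ih
    refine ⟨insert (box n φ) Δ, hfin.insert _, ⟨?_, ?_, ?_⟩, .inl rfl⟩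
    · grind [hΔ.left_mem]
    · grind [hΔ.right_mem]
    · grind [hΔ.body_mem]

variable {Δ w u : Set Formula}

theorem realization_mem_successors (hΔ : IsSubformulaClosed Δ) (hw : IsMaxConsistent w)
    (hwu : CanonicalRel j w u) (hu : ∀ χ ∈ Δ, χ ∈ realization (Δ ∩ u) ↔ χ ∈ u) :
    realization (Δ ∩ u) ∈ successors (Δ ∩ w) j := by
  refine mem_successors.2 ⟨isFounded_realization _, fun i hi χ ⟨hχΔ, hχw⟩ => ?_, fun i hi χ => ?_⟩
  · rw [hu _ hχΔ, hu _ (hΔ.body_mem hχΔ)]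
    exact hwu.mem_and_box_mem_of_le hw hi hχw
  · have hcongr : successors (Δ ∩ u) i = successors (Δ ∩ w) i :=
      successors_congr fun k hk θ => and_congr_right fun _ =>
        (hwu.box_mem_iff k (hk.trans_lt hi) θ).symm
    rw [← hcongr]
    exact box_mem_pointTheory

/-- The sets of the `ψ` with `[i]ψ ∈ Δ \ w`, for `i = 0, 1, …`. In the lexicographic order they
decrease along the edges of the canonical model used in the truth lemma. -/
def failedBoxes (Δ w : Set Formula) : Lex (ℕ → Set Formula) :=
  toLex fun i => {ψ | box i ψ ∈ Δ \ w}

theorem wellFounded_failedBoxes_lt (hfin : Δ.Finite) :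
    WellFounded ((· < ·) on failedBoxes Δ) := by
  rw [← Set.wellFoundedOn_range]
  let boxesOf : Set Formula → Lex (ℕ → Set Formula) := fun D => toLex fun i => {ψ | box i ψ ∈ D}
  refine ((hfin.finite_subsets.image boxesOf).subset ?_).wellFoundedOn
  rintro _ ⟨w, rfl⟩
  exact ⟨Δ \ w, Set.sdiff_subset, rfl⟩

theorem CanonicalRel.failedBoxes_lt {ψ : Formula} (h : CanonicalRel j w u) (hψ : box j ψ ∈ Δ)
    (hw : box j ψ ∉ w) (hu : box j ψ ∈ u) : failedBoxes Δ u < failedBoxes Δ w := by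
  refine ⟨j, fun i hi => Set.ext fun χ => ?_, fun χ hχ => ?_, fun hle => ?_⟩
  · exact and_congr_right fun _ => not_congr (h.box_mem_iff i hi χ).symm
  · exact ⟨hχ.1, fun hχw => hχ.2 (h.mem_and_box_mem χ hχw).2⟩
  · exact (hle (show ψ ∈ {ψ | box j ψ ∈ Δ \ w} from ⟨hψ, hw⟩)).2 hu

theorem mem_realization_iff (hfin : Δ.Finite) (hΔ : IsSubformulaClosed Δ)
    (hw : IsMaxConsistent w) {φ : Formula} (hφ : φ ∈ Δ) : φ ∈ realization (Δ ∩ w) ↔ φ ∈ w := by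
  induction w using (wellFounded_failedBoxes_lt hfin).induction generalizing φ with
  | _ w ih =>
  induction φ with
  | var p => exact and_iff_right hφ
  | bot => exact ⟨False.elim, hw.bot_notMem⟩
  | imp φ ψ ihφ ihψ =>
    have hiffφ := ihφ (hΔ.left_mem hφ)
    have hiffψ := ihψ (hΔ.right_mem hφ)
    rw [hw.imp_mem_iff, ← hiffφ, ← hiffψ]
    exact imp_mem_pointTheory
  | box j ψ _ =>
    refine ⟨fun h => ?_, fun h s hs => ((mem_successors.1 hs).2.1 j le_rfl ψ ⟨hφ, h⟩).1⟩
    by_contra hn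
    obtain ⟨u, hu, hwu, hψ, hbox⟩ := hw.exists_canonicalRel hn
    have truth : ∀ χ ∈ Δ, χ ∈ realization (Δ ∩ u) ↔ χ ∈ u := fun χ hχ =>
      ih u (hwu.failedBoxes_lt hφ hn hbox) hu hχ
    exact hψ ((truth ψ (hΔ.body_mem hφ)).1 (h _ (realization_mem_successors hΔ hw hwu truth)))

theorem exists_isFounded_notMem {φ : Formula} (h : ¬ Provable φ) : ∃ t, IsFounded t ∧ φ ∉ t := by
  obtain ⟨w, hw, -, hφw⟩ :=
    exists_isMaxConsistent_of_not_derivableFrom (mt DerivableFrom.provable h)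
  obtain ⟨Δ, hfin, hΔ, hφ⟩ := exists_finite_isSubformulaClosed φ
  exact ⟨realization (Δ ∩ w), isFounded_realization _,
    mt (mem_realization_iff hfin hΔ hw hφ).1 hφw⟩

end Realization

/-! ### Scattered topologies and soundness -/

theorem IsScattered.of_le {X : Type*} {σ τ : TopologicalSpace X} (hτ : IsScattered τ) (h : σ ≤ τ) :
    IsScattered σ := fun A hA => by
  obtain ⟨x, hx, U, hU, hUA⟩ := hτ A hA
  exact ⟨x, hx, U, h U hU, hUA⟩

section Scattered

variable {X : Type*} {τ : TopologicalSpace X} {A : Set X} {x : X}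

theorem notMem_derivedSet_iff : x ∉ derivedSet A ↔ ∀ᶠ y in 𝓝 x, y ≠ x → y ∉ A := by
  rw [mem_derivedSet, accPt_iff_frequently, not_frequently]
  simp only [not_and]

theorem IsScattered.exists_notMem_derivedSet (hτ : IsScattered τ) (hA : A.Nonempty) :
    ∃ x ∈ A, x ∉ derivedSet A := by
  obtain ⟨x, hx, U, hU, hUA⟩ := hτ A hA
  have hxU : x ∈ U := (hUA.ge rfl).1
  refine ⟨x, hx, ?_⟩
  rw [notMem_derivedSet_iff]
  filter_upwards [hU.mem_nhds hxU] with y hyU hne hyA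
  exact hne (hUA.le ⟨hyU, hyA⟩)

-- Dually `[n]([n]φ → φ) → [n]φ`: this is Löb's axiom.
theorem IsScattered.derivedSet_subset (hτ : IsScattered τ) (A : Set X) :
    derivedSet A ⊆ derivedSet (A \ derivedSet A) := by
  intro x hx
  by_contra hn
  rw [notMem_derivedSet_iff, eventually_nhds_iff] at hn
  obtain ⟨U, hU, hUo, hxU⟩ := hn
  have hC : insert x (U ∩ A) ⊆ U ∩ derivedSet A := by
    rintro y (rfl | ⟨hyU, hyA⟩)
    · exact ⟨hxU, hx⟩
    · refine ⟨hyU, ?_⟩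
      rcases eq_or_ne y x with rfl | hne
      · exact hx
      · by_contra hyd
        exact hU y hyU hne ⟨hyA, hyd⟩
  obtain ⟨y, hy, hyC⟩ := hτ.exists_notMem_derivedSet (Set.insert_nonempty x (U ∩ A))
  refine hyC (derivedSet_mono _ _ (Set.subset_insert x (U ∩ A)) ?_)
  exact (hC hy).2.nhds_inter (hUo.mem_nhds (hC hy).1)

theorem IsScattered.isClosed_derivedSet (hτ : IsScattered τ) (A : Set X) :
    IsClosed (derivedSet A) := by
  have derivedSet_closure : derivedSet (closure A) ⊆ derivedSet A :=
    (hτ.derivedSet_subset _).trans <| derivedSet_mono _ _ fun y ⟨hyC, hyd⟩ => by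
      rw [closure_eq_self_union_derivedSet] at hyC hyd
      exact hyC.resolve_right fun hyA => hyd (derivedSet_mono _ _ Set.subset_union_left hyA)
  rw [isClosed_iff_derivedSet_subset]
  refine (derivedSet_mono _ _ ?_).trans derivedSet_closure
  rw [closure_eq_self_union_derivedSet]
  exact Set.subset_union_right

end Scattered

section Soundness

variable {X : Type*} {τ : ℕ → TopologicalSpace X} {v : ℕ → Set X} {φ ψ : Formula} {x : X} {n : ℕ}

theorem IsGLPSpace.antitone (h : IsGLPSpace τ) : Antitone τ :=
  antitone_nat_of_succ_le h.increasing

theorem mem_value_imp {δ : ℕ → Set X → Set X} :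
    x ∈ value δ v (imp φ ψ) ↔ (x ∈ value δ v φ → x ∈ value δ v ψ) :=
  imp_iff_not_or.symm

theorem mem_value_box : x ∈ value (derivedOps τ) v (box n φ) ↔
    ∀ᶠ y in @nhds X (τ n) x, y ≠ x → y ∈ value (derivedOps τ) v φ := by
  rw [value, Set.mem_compl_iff, derivedOps, notMem_derivedSet_iff]
  simp only [Set.mem_compl_iff, not_not]

theorem propTruth_value {δ : ℕ → Set X → Set X} :
    propTruth (fun χ => x ∈ value δ v χ) φ ↔ x ∈ value δ v φ := by
  induction φ with
  | var p => exact Iff.rfl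
  | bot => exact Iff.rfl
  | imp φ ψ ihφ ihψ => rw [mem_value_imp, ← ihφ, ← ihψ]; exact Iff.rfl
  | box n φ _ => exact Iff.rfl

theorem Provable.valid (hτ : IsGLPSpace τ) (hφ : Provable φ) : Valid (derivedOps τ) φ := by
  intro v
  rw [Set.eq_univ_iff_forall]
  induction hφ with
  | taut _ h => exact fun x => propTruth_value.1 (h _)
  | distrib n φ ψ =>
    intro x
    simp only [mem_value_imp, mem_value_box]
    intro himp hφ
    filter_upwards [himp, hφ] with y hy hyφ hne using hy hne (hyφ hne)
  | loeb n φ =>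
    intro x
    rw [mem_value_imp]
    refine mt fun h => @derivedSet_mono X (τ n) _ _ ?_ _ ((hτ.scattered n).derivedSet_subset _ h)
    intro y hy hn
    exact hy.1 (mem_value_imp.1 hn hy.2)
  | mono m n φ hmn =>
    intro x
    rw [mem_value_imp, mem_value_box, mem_value_box]
    exact fun h => h.filter_mono (_root_.nhds_mono (hτ.antitone hmn.le))
  | negIntro m n φ hmn =>
    intro x
    rw [mem_value_imp, mem_value_box, value_dia]
    intro hx
    have hopen : IsOpen[τ n] (derivedOps τ m (value (derivedOps τ) v φ)) :=
      hτ.antitone hmn _ (hτ.derived_open m _)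
    exact (@IsOpen.eventually_mem X (τ n) _ _ hopen hx).mono fun _ hy _ => hy
  | mp _ _ _ _ ihφ ihimp => exact fun x => mem_value_imp.1 (ihimp x) (ihφ x)
  | nec n φ _ ih => exact fun x => mem_value_box.2 (.of_forall fun y _ => ih y)

end Soundness

/-! ### Topologies on a family of theories -/

section Reflection

variable {B : Type*} {th : B → Set Formula} {n : ℕ} {τ : TopologicalSpace B} {b : B}
  {ψ : Formula}

/-- The half of the truth condition for `[n]`, read on the points `b` with theories `th b`, that
survives coarsening the topology. -/
def ReflectsBox (th : B → Set Formula) (n : ℕ) (τ : TopologicalSpace B) : Prop :=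
  ∀ b ψ, (∀ᶠ y in @nhds B τ b, y ≠ b → ψ ∈ th y) → box n ψ ∈ th b

theorem ReflectsBox.succ (hth : ∀ b, IsMaxConsistent (th b)) (h : ReflectsBox th n τ) :
    ReflectsBox th (n + 1) τ := fun b ψ hψ =>
  (hth b).box_mem_of_le n.le_succ (h b ψ hψ)

/-- The filter generated by the conditions that the formulas `[n]χ` in the theory of `b` impose on
points near `b`. -/
def boxFilter (th : B → Set Formula) (n : ℕ) (b : B) : Filter B :=
  ⨅ χ ∈ {χ | box n χ ∈ th b}, 𝓟 {y | χ ∈ th y ∧ box n χ ∈ th y}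

theorem setOf_mem_boxFilter (h : box n ψ ∈ th b) :
    {y | ψ ∈ th y ∧ box n ψ ∈ th y} ∈ boxFilter th n b :=
  mem_iInf_of_mem ψ (mem_iInf_of_mem h (mem_principal_self _))

theorem exists_of_mem_boxFilter (hth : ∀ b, IsMaxConsistent (th b)) {s : Set B}
    (hs : s ∈ boxFilter th n b) :
    ∃ χ, box n χ ∈ th b ∧ {y | χ ∈ th y ∧ box n χ ∈ th y} ⊆ s := by
  have htop : Provable (imp bot bot) := .taut _ fun _ => id
  have hne : {χ | box n χ ∈ th b}.Nonempty := ⟨_, (hth b).mem_of_provable _ (.nec n _ htop)⟩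
  have hdir : DirectedOn ((fun χ => 𝓟 {y | χ ∈ th y ∧ box n χ ∈ th y}) ⁻¹'o (· ≥ ·))
      {χ | box n χ ∈ th b} := fun χ₁ h₁ χ₂ h₂ => by
    refine ⟨Formula.and χ₁ χ₂, (hth b).box_and_mem_iff.2 ⟨h₁, h₂⟩,
      principal_mono.2 fun y hy => ?_, principal_mono.2 fun y hy => ?_⟩
    · exact ⟨(((hth y).and_mem_iff _ _).1 hy.1).1, ((hth y).box_and_mem_iff.1 hy.2).1⟩
    · exact ⟨(((hth y).and_mem_iff _ _).1 hy.1).2, ((hth y).box_and_mem_iff.1 hy.2).2⟩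
  exact (mem_biInf_of_directed hdir hne).1 hs

/-- The refinement of `τ` that makes `[n]χ` imply `χ` at all nearby points. The point `b` itself
need not satisfy `χ`, so the filters defining it are not the neighborhood filters. -/
abbrev boxRefinement (th : B → Set Formula) (n : ℕ) (τ : TopologicalSpace B) : TopologicalSpace B :=
  .mkOfNhds fun b => @nhds B τ b ⊓ boxFilter th n b

theorem isOpen_boxRefinement {U : Set B} :
    IsOpen[boxRefinement th n τ] U ↔ ∀ b ∈ U, U ∈ 𝓝 b ⊓ boxFilter th n b := Iff.rfl

theorem boxRefinement_le : boxRefinement th n τ ≤ τ := fun _ hU =>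
  isOpen_boxRefinement.2 fun _ hb => mem_inf_of_left (hU.mem_nhds hb)

theorem nhds_inf_boxFilter_le (th : B → Set Formula) (n : ℕ) (τ : TopologicalSpace B) (b : B) :
    𝓝 b ⊓ boxFilter th n b ≤ @nhds B (boxRefinement th n τ) b := fun s hs => by
  obtain ⟨U, hUs, hU, hb⟩ := (@mem_nhds_iff B (boxRefinement th n τ) b s).1 hs
  exact mem_of_superset (isOpen_boxRefinement.1 hU b hb) hUs

theorem eventually_mem_of_box_mem {σ : TopologicalSpace B} (hσ : σ ≤ boxRefinement th n τ)
    (h : box n ψ ∈ th b) : ∀ᶠ y in @nhds B σ b, y ≠ b → ψ ∈ th y := by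
  have hU : IsOpen[boxRefinement th n τ] (insert b {y | ψ ∈ th y ∧ box n ψ ∈ th y}) := by
    refine isOpen_boxRefinement.2 fun y hy => mem_inf_of_right ?_
    have hbox : box n ψ ∈ th y := hy.elim (fun e => e ▸ h) And.right
    exact mem_of_superset (setOf_mem_boxFilter hbox) (Set.subset_insert _ _)
  filter_upwards [@IsOpen.mem_nhds B σ _ _ (hσ _ hU) (Set.mem_insert _ _)] with y hy hne
  exact (hy.resolve_left hne).1

theorem ReflectsBox.boxRefinement (hth : ∀ b, IsMaxConsistent (th b)) (h : ReflectsBox th n τ) :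
    ReflectsBox th n (boxRefinement th n τ) := fun b ψ hψ => by
  obtain ⟨s, hs, t, ht, hst⟩ := mem_inf_iff_superset.1 (nhds_inf_boxFilter_le th n τ b hψ)
  obtain ⟨χ, hχ, hχt⟩ := exists_of_mem_boxFilter hth ht
  have himp : box n (imp χ (imp (box n χ) ψ)) ∈ th b := by
    refine h b _ ?_
    filter_upwards [hs] with y hys hne
    rw [(hth y).imp_mem_iff, (hth y).imp_mem_iff]
    exact fun hχy hboxy => hst ⟨hys, hχt ⟨hχy, hboxy⟩⟩ hne
  exact (hth b).box_mp ((hth b).box_mp himp hχ) ((hth b).box_box_mem hχ)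

theorem reflectsBox_sInf {c : Set (TopologicalSpace B)} (hc : DirectedOn (· ≥ ·) c)
    (hne : c.Nonempty) (h : ∀ τ ∈ c, ReflectsBox th n τ) : ReflectsBox th n (sInf c) := by
  intro b ψ hψ
  have hdir : DirectedOn ((fun τ => @nhds B τ b) ⁻¹'o (· ≥ ·)) c :=
    fun σ hσ ρ hρ => (hc σ hσ ρ hρ).imp fun _ h =>
      ⟨h.1, _root_.nhds_mono h.2.1, _root_.nhds_mono h.2.2⟩
  rw [nhds_sInf] at hψ
  obtain ⟨τ, hτ, hψτ⟩ := (mem_biInf_of_directed hdir hne).1 hψ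
  exact h τ hτ b ψ hψτ

theorem ReflectsBox.exists_minimal (h : ReflectsBox th n τ) :
    ∃ σ ≤ τ, Minimal (ReflectsBox th n) σ :=
  zorn_le_nonempty₀ (α := (TopologicalSpace B)ᵒᵈ) {σ | ReflectsBox th n σ.ofDual}
    (fun c hcσ hc σ hσ => ⟨.toDual (sInf (OrderDual.toDual ⁻¹' c)),
      reflectsBox_sInf hc.directedOn ⟨σ, hσ⟩ hcσ, fun _ => sInf_le (α := TopologicalSpace B)⟩)
    (.toDual τ) h

theorem isOpen_insert_of_minimal (hτ : Minimal (ReflectsBox th n) τ) {O : Set B} (hO : IsOpen O)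
    (h : ∀ ψ, (∀ᶠ z in 𝓝 b, z ≠ b → z ∈ O → ψ ∈ th z) → box n ψ ∈ th b) :
    IsOpen (insert b O) := by
  have nhds_eq : ∀ c, @nhds B (τ ⊓ .generateFrom {insert b O}) c =
      𝓝 c ⊓ ⨅ s ∈ {s | c ∈ s ∧ s ∈ ({insert b O} : Set (Set B))}, 𝓟 s := fun c => by
    rw [nhds_inf, TopologicalSpace.nhds_generateFrom]
  have nhds_self_le : 𝓝 b ⊓ 𝓟 (insert b O) ≤ @nhds B (τ ⊓ .generateFrom {insert b O}) b := by
    rw [nhds_eq]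
    exact inf_le_inf_left _ (le_iInf₂ fun s hs => principal_mono.2 hs.2.ge)
  have nhds_le : ∀ c, c ≠ b → 𝓝 c ≤ @nhds B (τ ⊓ .generateFrom {insert b O}) c := fun c hne => by
    rw [nhds_eq]
    refine le_inf le_rfl (le_iInf₂ fun s ⟨hc, hs⟩ => le_principal_iff.2 ?_)
    obtain rfl : s = insert b O := hs
    exact mem_of_superset (hO.mem_nhds (hc.resolve_left hne)) (Set.subset_insert b O)
  have hinf : ReflectsBox th n (τ ⊓ .generateFrom {insert b O}) := fun c ψ hψ => by
    rcases eq_or_ne c b with rfl | hne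
    · refine h ψ ((eventually_inf_principal.1 (nhds_self_le hψ)).mono fun z hz hne hzO => ?_)
      exact hz (.inr hzO) hne
    · exact hτ.prop c ψ (nhds_le c hne hψ)
  exact (hτ.le_of_le hinf inf_le_left).trans inf_le_right _
    (TopologicalSpace.isOpen_generateFrom_of_mem rfl)

theorem exists_box_notMem_of_mem_derivedSet (hτ : Minimal (ReflectsBox th n) τ)
    (hscat : IsScattered τ) {Y : Set B} (hb : b ∈ derivedSet Y) :
    ∃ ψ, box n ψ ∉ th b ∧ ∀ᶠ w in 𝓝 b, box n ψ ∉ th w → w ∈ derivedSet Y := by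
  obtain ⟨ψ, hψ, hbox⟩ :
      ∃ ψ, (∀ᶠ z in 𝓝 b, z ≠ b → z ∈ (closure Y)ᶜ → ψ ∈ th z) ∧ box n ψ ∉ th b := by
    by_contra! h
    have hopen := isOpen_insert_of_minimal hτ isClosed_closure.isOpen_compl h
    refine notMem_derivedSet_iff.2 ?_ hb
    filter_upwards [hopen.mem_nhds (Set.mem_insert b _)] with y hy hne hyY
    exact hy.resolve_left hne (subset_closure hyY)
  refine ⟨ψ, hbox, ?_⟩
  filter_upwards [eventually_eventually_nhds.2 hψ] with w hw hboxw
  by_contra hwY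
  refine hboxw (hτ.prop w ψ ?_)
  filter_upwards [hw, notMem_derivedSet_iff.1 hwY,
    (hscat.isClosed_derivedSet Y).isOpen_compl.mem_nhds hwY] with z hz hzY hzd hne
  refine hz (fun e => hzd (e ▸ hb)) ?_
  rw [closure_eq_self_union_derivedSet]
  exact fun hzc => hzc.elim (hzY hne) hzd

theorem isOpen_derivedSet_boxRefinement (hth : ∀ b, IsMaxConsistent (th b)) {m : ℕ} (hmn : m < n)
    (hτ : Minimal (ReflectsBox th m) τ) (hscat : IsScattered τ) (Y : Set B) :
    IsOpen[boxRefinement th n τ] (derivedSet Y) := by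
  refine isOpen_boxRefinement.2 fun b hb => ?_
  obtain ⟨ψ, hψ, hnear⟩ := exists_box_notMem_of_mem_derivedSet hτ hscat hb
  have hneg := setOf_mem_boxFilter ((hth b).box_neg_box_mem hmn hψ)
  filter_upwards [mem_inf_of_left hnear, mem_inf_of_right hneg] with w hw hwneg
  exact hw (((hth w).neg_mem_iff _).1 hwneg.1)

theorem exists_isGLPSpace_of_reflectsBox [Nonempty B] (hth : ∀ b, IsMaxConsistent (th b))
    {σ : TopologicalSpace B} (hσ : ReflectsBox th 0 σ) (hscat : IsScattered σ) :
    ∃ τ : ℕ → TopologicalSpace B, IsGLPSpace τ ∧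
      ∀ n ψ b, box n ψ ∈ th b ↔ b ∉ derivedOps τ n {y | ψ ∈ th y}ᶜ := by
  have exists_next : ∀ n (ρ : {ρ // ReflectsBox th n ρ}), ∃ τ : {τ // ReflectsBox th (n + 1) τ},
      τ.1 ≤ boxRefinement th n ρ.1 ∧ Minimal (ReflectsBox th n) τ.1 := fun n ρ => by
    obtain ⟨τ, hle, hτ⟩ := (ρ.2.boxRefinement hth).exists_minimal
    exact ⟨⟨τ, hτ.prop.succ hth⟩, hle, hτ⟩
  choose next next_le minimal_next using exists_next
  let ρ : ∀ n, {ρ // ReflectsBox th n ρ} := fun n => Nat.rec ⟨σ, hσ⟩ next n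
  have hdec : Antitone fun n => (ρ n).1 :=
    antitone_nat_of_succ_le fun n => (next_le n (ρ n)).trans boxRefinement_le
  have hscatρ : ∀ n, IsScattered (ρ n).1 := fun n => hscat.of_le (hdec n.zero_le)
  refine ⟨fun n => (ρ (n + 1)).1, ⟨inferInstance, fun n => hscatρ (n + 1),
    fun n => hdec (n + 1).le_succ, fun n Y => ?_⟩, fun n ψ b => ?_⟩
  · exact next_le (n + 1) (ρ (n + 1)) _
      (isOpen_derivedSet_boxRefinement hth n.lt_succ_self (minimal_next n (ρ n)) (hscatρ (n + 1)) Y)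
  · rw [derivedOps, notMem_derivedSet_iff]
    simp only [Set.mem_compl_iff, Set.mem_ofPred_eq, not_not]
    exact ⟨eventually_mem_of_box_mem (next_le n (ρ n)), (minimal_next n (ρ n)).prop b ψ⟩

end Reflection

theorem isScattered_lowerSet {B : Type*} [PartialOrder B] [WellFoundedLT B] :
    IsScattered (Topology.lowerSet B) := fun A hA => by
  obtain ⟨m, hm, hmin⟩ := WellFounded.has_min (wellFounded_lt (α := B)) A hA
  refine ⟨m, hm, Set.Iic m, isLowerSet_Iic m, ?_⟩
  exact Set.Subset.antisymm (fun y ⟨hym, hy⟩ => hym.eq_or_lt.resolve_right (hmin y hy))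
    (Set.singleton_subset_iff.2 ⟨le_rfl, hm⟩)

theorem reflectsBox_lowerSet {B : Type*} [Preorder B] {th : B → Set Formula} {n : ℕ}
    (h : ∀ b ψ, box n ψ ∉ th b → ∃ y < b, ψ ∉ th y) : ReflectsBox th n (Topology.lowerSet B) := by
  intro b ψ hψ
  by_contra hn
  obtain ⟨y, hyb, hy⟩ := h b ψ hn
  obtain ⟨U, hUψ, hU, hbU⟩ := (@mem_nhds_iff B (Topology.lowerSet B) _ _).1 hψ
  exact hy (hUψ (hU hyb.le hbU) hyb.ne)

theorem exists_isGLPSpace_of_rank {B α : Type*} [Nonempty B] [Preorder α] [WellFoundedLT α]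
    {th : B → Set Formula} (hth : ∀ b, IsMaxConsistent (th b)) (rank : B → α)
    (h : ∀ b ψ, box 0 ψ ∉ th b → ∃ y, rank y < rank b ∧ ψ ∉ th y) :
    ∃ τ : ℕ → TopologicalSpace B, IsGLPSpace τ ∧
      ∀ n ψ b, box n ψ ∈ th b ↔ b ∉ derivedOps τ n {y | ψ ∈ th y}ᶜ := by
  let _ : PartialOrder B := partialOrderOfSO (rank ⁻¹'o (· < ·))
  have : WellFoundedLT B := ⟨InvImage.wf rank wellFounded_lt⟩
  exact exists_isGLPSpace_of_reflectsBox hth (reflectsBox_lowerSet h) isScattered_lowerSet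

/-! ### Completeness -/

theorem value_eq_setOf_mem {B : Type*} {th : B → Set Formula} {δ : ℕ → Set B → Set B}
    (hth : ∀ b, IsMaxConsistent (th b))
    (hδ : ∀ n ψ b, box n ψ ∈ th b ↔ b ∉ δ n {y | ψ ∈ th y}ᶜ) (φ : Formula) :
    value δ (fun p => {b | var p ∈ th b}) φ = {b | φ ∈ th b} := by
  induction φ with
  | var p => rfl
  | bot => exact (Set.eq_empty_of_forall_notMem fun b => (hth b).bot_notMem).symm
  | imp φ ψ ihφ ihψ =>
    ext b
    rw [mem_value_imp, ihφ, ihψ]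
    exact ((hth b).imp_mem_iff φ ψ).symm
  | box n φ ih =>
    ext b
    rw [value, ih]
    exact (hδ n φ b).symm

theorem exists_isGLPSpace_not_valid {φ : Formula} (h : ¬ Provable φ) :
    ∃ (X : Type u) (τ : ℕ → TopologicalSpace X), IsGLPSpace τ ∧ ¬ Valid (derivedOps τ) φ := by
  obtain ⟨t, ht, hφ⟩ := exists_isFounded_notMem h
  let B := ULift.{u} {t // IsFounded t}
  let th : B → Set Formula := fun b => b.down
  have hth : ∀ b, IsMaxConsistent (th b) := fun b => b.down.2.isMaxConsistent
  let rank : B → Ordinal.{0} := fun b => sInf {α | FoundedAt α (th b)}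
  have : Nonempty B := ⟨⟨t, ht⟩⟩
  obtain ⟨τ, hτ, hbox⟩ := exists_isGLPSpace_of_rank hth rank fun b ψ hψ => by
    have hb : FoundedAt (rank b) (th b) := csInf_mem (s := {α | FoundedAt α (th b)}) b.down.2
    obtain ⟨β, hβ, s, hs, -, hψs⟩ := (foundedAt_iff.1 hb).2 0 ψ hψ
    exact ⟨⟨s, β, hs⟩, (csInf_le' (s := {α | FoundedAt α s}) hs).trans_lt hβ, hψs⟩
  refine ⟨B, τ, hτ, fun hvalid => hφ ?_⟩
  have hmem : (⟨⟨t, ht⟩⟩ : B) ∈ {b | φ ∈ th b} := by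
    rw [← value_eq_setOf_mem hth hbox, hvalid]
    exact Set.mem_univ _
  exact hmem

end GLP

theorem mainTheorem1 :
    (∀ φ : GLP.Formula, ¬ GLP.Provable φ →
      ∃ (X : Type u) (τ : ℕ → TopologicalSpace X),
        GLP.IsGLPSpace τ ∧ ¬ GLP.Valid (GLP.derivedOps τ) φ) ∧
    GLP.logicOfGLPSpaces.{u} = {φ : GLP.Formula | GLP.Provable φ} := by
  have complete : ∀ φ : GLP.Formula, ¬ GLP.Provable φ →
      ∃ (X : Type u) (τ : ℕ → TopologicalSpace X),
        GLP.IsGLPSpace τ ∧ ¬ GLP.Valid (GLP.derivedOps τ) φ :=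
    fun φ => GLP.exists_isGLPSpace_not_valid
  refine ⟨complete, Set.ext fun φ => ⟨fun valid => ?_, fun hφ X τ hτ => hφ.valid hτ⟩⟩
  by_contra hφ
  obtain ⟨X, τ, hτ, refuted⟩ := complete φ hφ
  exact refuted (valid X τ hτ)
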